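/- Let $\mathcal Q$ be a small quantaloid, i.e. a small category whose hom-sets are complete lattices and whose composition preserves joins in each variable. A (small) $\mathcal Q$-category $\mathbb X$ is a set $\mathbb X_0$ with a type $|x|\in\operatorname{ob}\mathcal Q$ for each $x\in\mathbb X_0$ and arrows $\mathbb X(x,y):|x|\to|y|$ such that $1_{|x|}\le\mathbb X(x,x)$ and $\mathbb X(y,z)\circ\mathbb X(x,y)\le\mathbb X(x,z)$. Its underlying preorder is: $x\le y$ iff $|x|=|y|$ and $1_{|x|}\le\mathbb X(x,y)$. A $\mathcal Q$-functor $f:\mathbb X\to\mathbb Y$ is a type-preserving map with $\mathbb X(x,x')\le\mathbb Y(fx,fx')$; $\mathcal Q$-functors are preordered pointwise. A $\mathcal Q$-distributor $\phi$ from $\mathbb X$ to $\mathbb Y$ is a family of arrows $\phi(x,y):|x|\to|y|$ with $\mathbb Y(y,y')\circ\phi(x,y)\circ\mathbb X(x',x)\le\phi(x',y')$; distributors compose by $(\psi\circ\phi)(x,z)=\bigvee_{y}\psi(y,z)\circ\phi(x,y)$, and the identity on $\mathbb X$ is given by the arrows $\mathbb X(x,y)$. A presheaf $\mu$ on $\mathbb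 X$ of type $|\mu|=q$ is a family of arrows $\mu(x):|x|\to q$ with $\mu(x)\circ\mathbb X(x',x)\le\mu(x')$. Presheaves on $\mathbb X$ form a $\mathcal Q$-category $\mathsf P\mathbb X$, in which $\mathsf P\mathbb X(\mu,\nu)$ is the largest arrow $g:|\mu|\to|\nu|$ such that $g\circ\mu(x)\le\nu(x)$ for all $x$. A distributor $\phi$ from $\mathbb X$ to $\mathbb Y$ induces the $\mathcal Q$-functor $\phi^*:\mathsf P\mathbb Y\to\mathsf P\mathbb X$, $(\phi^*\lambda)(x)=\bigvee_y\lambda(y)\circ\phi(x,y)$. A $\mathcal Q$-closure space $(\mathbb X,c)$ is a $\mathcal Q$-category $\mathbb X$ with a $\mathcal Q$-functor $c:\mathsf P\mathbb X\to\mathsf P\mathbb X$ such that $1\le c$ and $cc\le c$. A distributor $\zeta$ from $\mathbb X$ to $\mathbb Y$ is continuous from $(\mathbb X,c)$ to $(\mathbb Y,d)$ if $\zeta^*d\le c\,\zeta^*$, and it is closed if moreover $c(\zeta(-,y))=\zeta(-,y)$ for every $y\in\mathbb Y_0$. The closure $\mathrm{cl}\,\zeta$ of a continuous distributor $\zeta$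 is defined by $(\mathrm{cl}\,\zeta)(-,y)=c(\zeta(-,y))$. Let $(\mathcal Q\text{-}\mathbf{ClsDist})_{\mathrm{cl}}$ be the quantaloid whose objects are the $\mathcal Q$-closure spaces and whose arrows $(\mathbb X,c)\to(\mathbb Y,d)$ are the closed continuous distributors, ordered pointwise, with composition $(\eta,\zeta)\mapsto\mathrm{cl}(\eta\circ\zeta)$, with identity $\mathrm{cl}(\mathrm{id}_{\mathbb X})$ on $(\mathbb X,c)$, and with joins of arrows $\mathrm{cl}\big(\bigvee_i\zeta_i\big)$. Then the category $(\mathcal Q\text{-}\mathbf{ClsDist})_{\mathrm{cl}}$ is complete and cocomplete: it has all small limits and all small colimits. -/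

import Mathlib

open CategoryTheory

universe v u

namespace QEnr

/-- A quantaloid: a category whose hom-sets are complete lattices and whose composition preserves
joins in each variable. -/
class Quantaloid (C : Type u) [Category.{v} C] where
  homLattice : ∀ p q : C, CompleteLattice (p ⟶ q)
  comp_sSup : ∀ {p q r : C} (f : p ⟶ q) (S : Set (q ⟶ r)), f ≫ sSup S = ⨆ g ∈ S, f ≫ g
  sSup_comp : ∀ {p q r : C} (S : Set (p ⟶ q)) (g : q ⟶ r), sSup S ≫ g = ⨆ f ∈ S, f ≫ g

attribute [reducible, instance] Quantaloid.homLattice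

section Quantaloid

variable {C : Type u} [Category.{v} C] [Quantaloid C]

theorem comp_iSup {p q r : C} {ι : Sort*} (f : p ⟶ q) (g : ι → (q ⟶ r)) :
    f ≫ (⨆ i, g i) = ⨆ i, f ≫ g i := by
  rw [iSup, Quantaloid.comp_sSup, iSup_range]

theorem iSup_comp {p q r : C} {ι : Sort*} (f : ι → (p ⟶ q)) (g : q ⟶ r) :
    (⨆ i, f i) ≫ g = ⨆ i, f i ≫ g := by
  rw [iSup, Quantaloid.sSup_comp, iSup_range]

theorem comp_mono {p q r : C} {f f' : p ⟶ q} {g g' : q ⟶ r} (hf : f ≤ f') (hg : g ≤ g') :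
    f ≫ g ≤ f' ≫ g' := by
  have h1 : f ≫ g ≤ f' ≫ g := by
    have h := Quantaloid.sSup_comp {f, f'} g
    rw [sSup_pair, sup_eq_right.2 hf] at h
    rw [h]
    exact le_iSup₂_of_le f (by simp) le_rfl
  have h2 : f' ≫ g ≤ f' ≫ g' := by
    have h := Quantaloid.comp_sSup f' {g, g'}
    rw [sSup_pair, sup_eq_right.2 hg] at h
    rw [h]
    exact le_iSup₂_of_le g (by simp) le_rfl
  exact h1.trans h2

/-- The left implication `w ↙ f`: the largest `g` with `g ∘ f ≤ w`. -/
def leftImp {p q r : C} (w : p ⟶ r) (f : p ⟶ q) : q ⟶ r :=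
  sSup {g | f ≫ g ≤ w}

theorem le_leftImp {p q r : C} {w : p ⟶ r} {f : p ⟶ q} {g : q ⟶ r} :
    g ≤ leftImp w f ↔ f ≫ g ≤ w := by
  constructor
  · intro h
    refine (comp_mono le_rfl h).trans ?_
    rw [leftImp, Quantaloid.comp_sSup]
    exact iSup₂_le fun _ h => h
  · intro h
    exact le_sSup h

end Quantaloid

variable {Q : Type u} [SmallCategory Q] [Quantaloid Q]

variable (Q) in
/-- A (small) `Q`-category: a set of objects, each with a type in the set of objects of `Q`,
together with a reflexive and transitive `Q`-relation on it. -/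
structure QCat where
  Obj : Type u
  typ : Obj → Q
  hom : ∀ x y : Obj, typ x ⟶ typ y
  id_le : ∀ x, 𝟙 (typ x) ≤ hom x x
  comp_le : ∀ x y z, hom x y ≫ hom y z ≤ hom x z

/-- The underlying preorder of a `Q`-category: `x ≤ y` iff `|x| = |y|` and `1 ≤ X(x, y)`. -/
def QCat.Le (X : QCat Q) (x y : X.Obj) : Prop :=
  ∃ h : X.typ x = X.typ y, eqToHom h ≤ X.hom x y

/-- A `Q`-functor: a type-preserving map `f` with `X(x, x') ≤ Y(f x, f x')`. The `eqToHom`s are the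
identifications `|f x| = |x|`. -/
@[ext]
structure QFunctor (X Y : QCat Q) where
  obj : X.Obj → Y.Obj
  typ_obj : ∀ x, Y.typ (obj x) = X.typ x
  hom_le : ∀ x x', X.hom x x' ≤
    eqToHom (typ_obj x).symm ≫ Y.hom (obj x) (obj x') ≫ eqToHom (typ_obj x')

/-- A `Q`-closure operator on `X`: a `Q`-functor `c : X → X` with `1 ≤ c` and `c c ≤ c`. -/
structure ClosureOp (X : QCat Q) extends QFunctor X X where
  le_obj : ∀ x, X.Le x (obj x)
  obj_obj_le : ∀ x, X.Le (obj (obj x)) (obj x)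

/-- A `Q`-distributor `φ : X ⇸ Y`: a family of arrows `φ(x, y) : |x| ⟶ |y|` with
`Y(y, y') ∘ φ(x, y) ∘ X(x', x) ≤ φ(x', y')`. -/
@[ext]
structure Dist (X Y : QCat Q) where
  val : ∀ (x : X.Obj) (y : Y.Obj), X.typ x ⟶ Y.typ y
  act_le : ∀ x' x y y', X.hom x' x ≫ val x y ≫ Y.hom y y' ≤ val x' y'

/-- A presheaf of type `q` on `X`, that is, a `Q`-distributor from `X` to the one-object discrete
`Q`-category `{q}`, written out. -/
@[ext]
structure Presheaf (X : QCat Q) where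
  typ : Q
  val : ∀ x : X.Obj, X.typ x ⟶ typ
  act_le : ∀ x' x, X.hom x' x ≫ val x ≤ val x'

/-- The `Q`-category `P X` of presheaves on `X`, with
`(P X)(μ, ν) = ν ↙ μ = ⋀ x, ν(x) ↙ μ(x)`. -/
@[reducible]
def QCat.psh (X : QCat Q) : QCat Q where
  Obj := Presheaf X
  typ := Presheaf.typ
  hom μ ν := ⨅ x, leftImp (ν.val x) (μ.val x)
  id_le μ := le_iInf fun x => le_leftImp.2 (by simp)
  comp_le μ ν ρ := le_iInf fun x => le_leftImp.2 (by
    rw [← Category.assoc]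
    exact (comp_mono (le_leftImp.1 (iInf_le _ x)) le_rfl).trans (le_leftImp.1 (iInf_le _ x)))

theorem le_psh_hom {X : QCat Q} {μ ν : Presheaf X} {s : μ.typ ⟶ ν.typ} :
    s ≤ X.psh.hom μ ν ↔ ∀ x, μ.val x ≫ s ≤ ν.val x := by
  simp only [le_iInf_iff, le_leftImp]

theorem psh_le_iff {X : QCat Q} {μ ν : Presheaf X} :
    X.psh.Le μ ν ↔ ∃ h : μ.typ = ν.typ, ∀ x, μ.val x ≫ eqToHom h ≤ ν.val x :=
  exists_congr fun _ => le_psh_hom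

namespace Dist

variable {X Y Z : QCat Q}

theorem left_act_le (φ : Dist X Y) (x' x : X.Obj) (y : Y.Obj) :
    X.hom x' x ≫ φ.val x y ≤ φ.val x' y := by
  refine le_trans ?_ (φ.act_le x' x y y)
  refine comp_mono le_rfl ?_
  simpa using comp_mono (le_refl (φ.val x y)) (Y.id_le y)

theorem right_act_le (φ : Dist X Y) (x : X.Obj) (y y' : Y.Obj) :
    φ.val x y ≫ Y.hom y y' ≤ φ.val x y' := by
  refine le_trans ?_ (φ.act_le x x y y')
  simpa using comp_mono (X.id_le x) (le_refl (φ.val x y ≫ Y.hom y y'))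

/-- Build a distributor from the two one-sided action inequalities. -/
@[reducible]
def mk' (val : ∀ (x : X.Obj) (y : Y.Obj), X.typ x ⟶ Y.typ y)
    (hl : ∀ x' x y, X.hom x' x ≫ val x y ≤ val x' y)
    (hr : ∀ x y y', val x y ≫ Y.hom y y' ≤ val x y') : Dist X Y where
  val := val
  act_le x' x y y' := (comp_mono le_rfl (hr x y y')).trans (hl x' x y')

/-- The identity distributor on `X`, given by the hom-arrows of `X`. -/
@[reducible]
def id (X : QCat Q) : Dist X X :=
  mk' X.hom X.comp_le X.comp_le

/-- The composite `ψ ∘ φ : X ⇸ Z`, with `(ψ ∘ φ)(x, z) = ⋁ y, ψ(y, z) ∘ φ(x, y)`. -/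
@[reducible]
def comp (φ : Dist X Y) (ψ : Dist Y Z) : Dist X Z :=
  mk' (fun x z => ⨆ y, φ.val x y ≫ ψ.val y z)
    (fun x' x z => by
      rw [comp_iSup]
      refine iSup_mono fun y => ?_
      rw [← Category.assoc]
      exact comp_mono (φ.left_act_le x' x y) le_rfl)
    (fun x z z' => by
      rw [iSup_comp]
      refine iSup_mono fun y => ?_
      rw [Category.assoc]
      exact comp_mono le_rfl (ψ.right_act_le y z z'))

/-- The join of a set of distributors, computed pointwise. -/
@[reducible]
def sup (S : Set (Dist X Y)) : Dist X Y :=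
  mk' (fun x y => ⨆ φ ∈ S, φ.val x y)
    (fun x' x y => by
      simp only [comp_iSup]
      exact iSup₂_mono fun φ _ => φ.left_act_le x' x y)
    (fun x y y' => by
      simp only [iSup_comp]
      exact iSup₂_mono fun φ _ => φ.right_act_le x y y')

/-- The functor `φ^* : P Y → P X`, `μ ↦ μ ∘ φ`, induced by a distributor `φ : X ⇸ Y`. -/
@[reducible]
def star (φ : Dist X Y) : QFunctor Y.psh X.psh where
  obj (μ : Presheaf Y) :=
    ({ typ := μ.typ
       val := fun x => ⨆ y, φ.val x y ≫ μ.val y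
       act_le := fun x' x => by
        rw [comp_iSup]
        refine iSup_mono fun y => ?_
        rw [← Category.assoc]
        exact comp_mono (φ.left_act_le x' x y) le_rfl } : Presheaf X)
  typ_obj _ := rfl
  hom_le (μ ν : Presheaf Y) := by
    simp only [eqToHom_refl, Category.id_comp, Category.comp_id]
    refine le_iInf fun x => le_leftImp.2 ?_
    rw [iSup_comp]
    refine iSup_mono fun y => ?_
    rw [Category.assoc]
    exact comp_mono le_rfl ((le_psh_hom (s := Y.psh.hom μ ν)).1 le_rfl y)

/-- The value `φ(-, y)` at `y` of the transpose `Y → P X` of `φ : X ⇸ Y`. -/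
@[reducible]
def transpose (φ : Dist X Y) (y : Y.Obj) : Presheaf X where
  typ := Y.typ y
  val x := φ.val x y
  act_le x' x := φ.left_act_le x' x y

end Dist

variable (Q) in
/-- A `Q`-closure space `(X, c)`: a `Q`-category `X` with a `Q`-closure operator `c` on `P X`. -/
structure ClsSpace where
  cat : QCat Q
  op : ClosureOp cat.psh

namespace ClsSpace

/-- `c μ` for a presheaf `μ`. -/
def close (X : ClsSpace Q) (μ : Presheaf X.cat) : Presheaf X.cat := X.op.obj μ

theorem typ_close (X : ClsSpace Q) (μ : Presheaf X.cat) : (X.close μ).typ = μ.typ :=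
  X.op.typ_obj μ

/-- The value `(c μ)(x)`, regarded as an arrow `|x| ⟶ |μ|` through `|c μ| = |μ|`. -/
def app (X : ClsSpace Q) (μ : Presheaf X.cat) (x : X.cat.Obj) : X.cat.typ x ⟶ μ.typ :=
  (X.close μ).val x ≫ eqToHom (X.typ_close μ)

variable (X : ClsSpace Q)

theorem act_app_le (μ : Presheaf X.cat) (x' x : X.cat.Obj) :
    X.cat.hom x' x ≫ X.app μ x ≤ X.app μ x' := by
  rw [app, ← Category.assoc]
  exact comp_mono ((X.close μ).act_le x' x) le_rfl

theorem comp_eqToHom_le_iff {p q r : Q} (f : p ⟶ q) (h : q = r) (g : p ⟶ r) :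
    f ≫ eqToHom h ≤ g ↔ f ≤ g ≫ eqToHom h.symm := by
  subst h; simp

theorem val_le_app (μ : Presheaf X.cat) (x : X.cat.Obj) : μ.val x ≤ X.app μ x := by
  obtain ⟨h, hx⟩ := psh_le_iff.1 (X.op.le_obj μ)
  exact (comp_eqToHom_le_iff _ h _).1 (hx x)

theorem app_close_le (μ : Presheaf X.cat) (x : X.cat.Obj) :
    X.app (X.close μ) x ≤ (X.close μ).val x := by
  obtain ⟨h, hx⟩ := psh_le_iff.1 (X.op.obj_obj_le μ)
  exact hx x

theorem app_comp_le {μ ν : Presheaf X.cat} {s : μ.typ ⟶ ν.typ}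
    (h : ∀ x, μ.val x ≫ s ≤ X.app ν x) (x : X.cat.Obj) : X.app μ x ≫ s ≤ X.app ν x := by
  have h1 : s ≫ eqToHom (X.typ_close ν).symm ≤ X.cat.psh.hom μ (X.close ν) := by
    refine le_psh_hom.2 fun x => ?_
    rw [← Category.assoc]
    exact (comp_eqToHom_le_iff _ _ _).2 (h x)
  have h2 := h1.trans (X.op.hom_le μ (X.close ν))
  have h3 : eqToHom (X.typ_close μ) ≫ (s ≫ eqToHom (X.typ_close ν).symm) ≫
      eqToHom (X.typ_close (X.close ν)).symm ≤
      X.cat.psh.hom (X.close μ) (X.close (X.close ν)) := by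
    refine (comp_mono le_rfl (comp_mono h2 le_rfl)).trans (le_of_eq ?_)
    erw [Category.assoc, Category.assoc, eqToHom_trans, eqToHom_trans_assoc]
    simp only
    erw [Category.comp_id, Category.id_comp]
    rfl
  have h4 := le_psh_hom.1 h3 x
  have h5 : X.app μ x ≫ s ≫ eqToHom (X.typ_close ν).symm ≤ X.app (X.close ν) x := by
    refine (comp_eqToHom_le_iff _ (X.typ_close (X.close ν)).symm _).1 ?_
    simpa [app] using h4
  have h6 := h5.trans (X.app_close_le ν x)
  rw [← Category.assoc] at h6
  exact (comp_eqToHom_le_iff _ _ _).1 h6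

theorem app_mono {μ ν : Presheaf X.cat} (h : μ.typ = ν.typ)
    (hx : ∀ x, μ.val x ≫ eqToHom h ≤ X.app ν x) (x : X.cat.Obj) :
    X.app μ x ≫ eqToHom h ≤ X.app ν x :=
  X.app_comp_le hx x

end ClsSpace

/-- A distributor `ζ : X ⇸ Y` between `Q`-closure spaces is continuous if
`ζ^* d ≤ c ζ^* : P Y → P X`. -/
def Dist.IsContinuous {X Y : ClsSpace Q} (ζ : Dist X.cat Y.cat) : Prop :=
  ∀ μ : Presheaf Y.cat, X.cat.psh.Le (ζ.star.obj (Y.op.obj μ)) (X.op.obj (ζ.star.obj μ))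

/-- A distributor `ζ : X ⇸ Y` between `Q`-closure spaces is closed if `ζ(-, y)` is a closed
presheaf, i.e. a fixed point of `c`, for every `y`. -/
def Dist.IsClosed {X Y : ClsSpace Q} (ζ : Dist X.cat Y.cat) : Prop :=
  ∀ y, X.op.obj (ζ.transpose y) = ζ.transpose y

section

variable {X Y Z : ClsSpace Q}

theorem isContinuous_iff {ζ : Dist X.cat Y.cat} : ζ.IsContinuous (X := X) (Y := Y) ↔
    ∀ (μ : Presheaf Y.cat) x y, ζ.val x y ≫ Y.app μ y ≤ X.app (ζ.star.obj μ) x := by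
  have key : ∀ μ : Presheaf Y.cat,
      X.cat.psh.Le (ζ.star.obj (Y.op.obj μ)) (X.op.obj (ζ.star.obj μ)) ↔
      ∀ x y, ζ.val x y ≫ Y.app μ y ≤ X.app (ζ.star.obj μ) x := by
    intro μ
    have h0 : (Y.close μ).typ = (X.close (ζ.star.obj μ)).typ :=
      (Y.typ_close μ).trans (X.typ_close (ζ.star.obj μ)).symm
    have h1 : (∀ x, (⨆ y, ζ.val x y ≫ (Y.close μ).val y) ≫ eqToHom h0 ≤
        (X.close (ζ.star.obj μ)).val x) ↔
        ∀ x y, ζ.val x y ≫ Y.app μ y ≤ X.app (ζ.star.obj μ) x := by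
      refine forall_congr' fun x => ?_
      rw [iSup_comp, iSup_le_iff]
      refine forall_congr' fun y => ?_
      have := ClsSpace.comp_eqToHom_le_iff (ζ.val x y ≫ Y.app μ y) (X.typ_close (ζ.star.obj μ)).symm
        ((X.close (ζ.star.obj μ)).val x)
      refine Iff.trans ?_ this
      simp [ClsSpace.app]
    rw [← h1]
    exact psh_le_iff.trans ⟨fun ⟨_, h⟩ => h, fun h => ⟨h0, h⟩⟩
  exact forall_congr' key

theorem isClosed_iff {ζ : Dist X.cat Y.cat} : ζ.IsClosed (X := X) (Y := Y) ↔
    ∀ x y, X.app (ζ.transpose y) x ≤ ζ.val x y := by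
  constructor
  · intro h x y
    have aux : ∀ (μ ν : Presheaf X.cat) (h : μ = ν) (h' : μ.typ = ν.typ),
        μ.val x ≫ eqToHom h' ≤ ν.val x := by
      rintro μ _ rfl _
      simp
    exact aux _ _ (h y) (X.typ_close _)
  · intro h y
    have aux : ∀ (μ ν : Presheaf X.cat) (h' : μ.typ = ν.typ),
        (∀ x, μ.val x ≫ eqToHom h' = ν.val x) → μ = ν := by
      rintro ⟨p, a, ha⟩ ⟨q, b, hb⟩ h' hx
      obtain rfl : p = q := h'
      have : a = b := funext fun x => by simpa using hx x
      subst this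
      rfl
    exact aux (X.close (ζ.transpose y)) (ζ.transpose y) (X.typ_close _)
      fun x => le_antisymm (h x y) (X.val_le_app (ζ.transpose y) x)

end

/-- A continuous `Q`-distributor `(X, c) ⇸ (Y, d)`. -/
@[ext]
structure ContDist (X Y : ClsSpace Q) extends Dist X.cat Y.cat where
  cont : toDist.IsContinuous (X := X) (Y := Y)

namespace ContDist

variable {X Y Z W : ClsSpace Q}

theorem le_app (ζ : ContDist X Y) (μ : Presheaf Y.cat) (x : X.cat.Obj) (y : Y.cat.Obj) :
    ζ.val x y ≫ Y.app μ y ≤ X.app (ζ.toDist.star.obj μ) x :=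
  isContinuous_iff.1 ζ.cont μ x y

theorem comp_app_le (ζ : ContDist X Y) {μ : Presheaf Y.cat} {ν : Presheaf X.cat}
    (h : μ.typ = ν.typ) (hx : ∀ x y, (ζ.val x y ≫ μ.val y) ≫ eqToHom h ≤ X.app ν x)
    (x : X.cat.Obj) (y : Y.cat.Obj) :
    (ζ.val x y ≫ Y.app μ y) ≫ eqToHom h ≤ X.app ν x := by
  refine (comp_mono (ζ.le_app μ x y) le_rfl).trans ?_
  refine X.app_mono (μ := ζ.toDist.star.obj μ) h (fun x => ?_) x
  exact (le_of_eq (iSup_comp _ _)).trans (iSup_le fun y => hx x y)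

/-- The identity continuous distributor. -/
@[reducible]
def id (X : ClsSpace Q) : ContDist X X where
  toDist := Dist.id X.cat
  cont := isContinuous_iff.2 fun μ x y => by
    refine (X.act_app_le μ x y).trans ?_
    have := X.app_mono (μ := μ) (ν := (Dist.id X.cat).star.obj μ) rfl (fun x => ?_) x
    · simpa using this
    · rw [eqToHom_refl, Category.comp_id]
      refine le_trans ?_ (X.val_le_app _ x)
      refine le_trans ?_ (le_iSup (fun y => X.cat.hom x y ≫ μ.val y) x)
      simpa using comp_mono (X.cat.id_le x) (le_refl (μ.val x))

/-- The composite `η ∘ ζ` of continuous distributors, computed as for distributors. -/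
@[reducible]
def comp (ζ : ContDist X Y) (η : ContDist Y Z) : ContDist X Z where
  toDist := ζ.toDist.comp η.toDist
  cont := isContinuous_iff.2 fun μ x z => by
    refine (le_of_eq (iSup_comp _ _)).trans (iSup_le fun y => ?_)
    rw [Category.assoc]
    refine (comp_mono le_rfl (η.le_app μ y z)).trans ?_
    have := ζ.comp_app_le (μ := η.toDist.star.obj μ)
      (ν := (ζ.toDist.comp η.toDist).star.obj μ) rfl (fun x y => ?_) x y
    · simpa using this
    · rw [eqToHom_refl, Category.comp_id]
      refine le_trans ?_ (X.val_le_app _ x)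
      refine (le_of_eq (comp_iSup _ _)).trans (iSup_le fun z => ?_)
      refine le_trans ?_ (le_iSup (fun z => (ζ.toDist.comp η.toDist).val x z ≫ μ.val z) z)
      rw [← Category.assoc]
      exact comp_mono (le_iSup (fun y => ζ.val x y ≫ η.val y z) y) le_rfl

/-- The join of a set of continuous distributors, computed pointwise. -/
def sup (S : Set (ContDist X Y)) : ContDist X Y where
  toDist := Dist.sup (ContDist.toDist '' S)
  cont := isContinuous_iff.2 fun μ x y => by
    refine (le_of_eq (iSup_comp _ _)).trans (iSup_le fun φ => ?_)
    rw [iSup_comp]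
    refine iSup_le fun hφ => ?_
    obtain ⟨ζ, hζ, rfl⟩ := hφ
    have := ζ.comp_app_le (μ := μ)
      (ν := (Dist.sup (ContDist.toDist '' S)).star.obj μ) rfl (fun x y => ?_) x y
    · simpa using this
    · rw [eqToHom_refl, Category.comp_id]
      refine le_trans ?_ (X.val_le_app _ x)
      refine le_trans ?_ (le_iSup
        (fun y => (Dist.sup (ContDist.toDist '' S)).val x y ≫ μ.val y) y)
      exact comp_mono (le_iSup₂_of_le ζ.toDist ⟨ζ, hζ, rfl⟩ le_rfl) le_rfl

/-- The closure `cl ζ` of a continuous distributor, whose transpose is `c` composed with the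
transpose of `ζ`, i.e. `(cl ζ)(-, y) = c(ζ(-, y))`. -/
@[reducible]
def cl (ζ : ContDist X Y) : ContDist X Y where
  toDist := Dist.mk' (fun x y => X.app (ζ.transpose y) x)
    (fun x' x y => X.act_app_le (ζ.transpose y) x' x)
    (fun x y y' => X.app_comp_le (μ := ζ.transpose y) (ν := ζ.transpose y')
      (fun x => (ζ.right_act_le x y y').trans (X.val_le_app (ζ.transpose y') x)) x)
  cont := isContinuous_iff.2 fun μ x y => by
    refine X.app_comp_le (μ := ζ.transpose y) (ν := Dist.star _ |>.obj μ) (fun x => ?_) x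
    have := ζ.comp_app_le (μ := μ) (ν := Dist.star (Dist.mk' (fun x y => X.app (ζ.transpose y) x)
      (fun x' x y => X.act_app_le (ζ.transpose y) x' x)
      (fun x y y' => X.app_comp_le (μ := ζ.transpose y) (ν := ζ.transpose y')
      (fun x => (ζ.right_act_le x y y').trans (X.val_le_app (ζ.transpose y') x)) x)) |>.obj μ)
      rfl (fun x y => ?_) x y
    · simpa using this
    · rw [eqToHom_refl, Category.comp_id]
      refine le_trans ?_ (X.val_le_app _ x)
      refine le_trans ?_ (le_iSup (fun y => X.app (ζ.transpose y) x ≫ μ.val y) y)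
      exact comp_mono (X.val_le_app (ζ.transpose y) x) le_rfl

theorem val_le_cl (ζ : ContDist X Y) (x : X.cat.Obj) (y : Y.cat.Obj) :
    ζ.val x y ≤ ζ.cl.val x y :=
  X.val_le_app (ζ.transpose y) x

theorem cl_le {ζ η : ContDist X Y} (h : ∀ x y, ζ.val x y ≤ η.cl.val x y)
    (x : X.cat.Obj) (y : Y.cat.Obj) : ζ.cl.val x y ≤ η.cl.val x y := by
  have := X.app_mono (μ := ζ.transpose y) (ν := η.transpose y) rfl
    (fun x => by rw [eqToHom_refl, Category.comp_id]; exact h x y) x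
  rwa [eqToHom_refl, Category.comp_id] at this

theorem cl_isClosed (ζ : ContDist X Y) : ζ.cl.IsClosed (X := X) (Y := Y) :=
  isClosed_iff.2 fun x y => cl_le (fun _ _ => le_rfl) x y

theorem ext_val {ζ η : ContDist X Y} (h : ∀ x y, ζ.val x y = η.val x y) : ζ = η :=
  ContDist.ext (funext fun x => funext fun y => h x y)

theorem cl_eq_of_le {ζ η : ContDist X Y} (h : ∀ x y, ζ.val x y ≤ η.cl.val x y)
    (h' : ∀ x y, η.val x y ≤ ζ.cl.val x y) : ζ.cl = η.cl :=
  ext_val fun x y => le_antisymm (cl_le h x y) (cl_le h' x y)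

theorem val_comp_le_iff {ζ : ContDist X Y} {η : ContDist Y Z} {x : X.cat.Obj} {z : Z.cat.Obj}
    {t : X.cat.typ x ⟶ Z.cat.typ z} :
    (ζ.comp η).val x z ≤ t ↔ ∀ y, ζ.val x y ≫ η.val y z ≤ t :=
  iSup_le_iff

theorem le_val_comp (ζ : ContDist X Y) (η : ContDist Y Z) (x : X.cat.Obj) (y : Y.cat.Obj)
    (z : Z.cat.Obj) : ζ.val x y ≫ η.val y z ≤ (ζ.comp η).val x z :=
  val_comp_le_iff.1 le_rfl y

theorem comp_le_comp {ζ ζ' : ContDist X Y} {η η' : ContDist Y Z}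
    (h : ∀ x y, ζ.val x y ≤ ζ'.val x y) (h' : ∀ y z, η.val y z ≤ η'.val y z)
    (x : X.cat.Obj) (z : Z.cat.Obj) : (ζ.comp η).val x z ≤ (ζ'.comp η').val x z :=
  iSup_mono fun y => comp_mono (h x y) (h' y z)

theorem cl_comp_le {ζ : ContDist X Y} {η : ContDist Y Z} {θ : ContDist X Z}
    (h : ∀ x z, (ζ.comp η).val x z ≤ θ.cl.val x z) (x : X.cat.Obj) (z : Z.cat.Obj) :
    (ζ.cl.comp η).val x z ≤ θ.cl.val x z :=
  val_comp_le_iff.2 fun y => X.app_comp_le (μ := ζ.transpose y) (ν := θ.transpose z)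
    (fun x => (ζ.le_val_comp η x y z).trans (h x z)) x

theorem comp_cl_le {ζ : ContDist X Y} {η : ContDist Y Z} {θ : ContDist X Z}
    (h : ∀ x z, (ζ.comp η).val x z ≤ θ.cl.val x z) (x : X.cat.Obj) (z : Z.cat.Obj) :
    (ζ.comp η.cl).val x z ≤ θ.cl.val x z :=
  val_comp_le_iff.2 fun y => by
    have := ζ.comp_app_le (μ := η.transpose z) (ν := θ.transpose z) rfl
      (fun x y => by
        rw [eqToHom_refl, Category.comp_id]
        exact (ζ.le_val_comp η x y z).trans (h x z)) x y
    rwa [eqToHom_refl, Category.comp_id] at this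

theorem cl_cl_comp (ζ : ContDist X Y) (η : ContDist Y Z) :
    (ζ.cl.comp η).cl = (ζ.comp η).cl :=
  cl_eq_of_le (cl_comp_le (val_le_cl _)) fun x z =>
    (comp_le_comp ζ.val_le_cl (fun _ _ => le_rfl) x z).trans (val_le_cl _ x z)

theorem cl_comp_cl (ζ : ContDist X Y) (η : ContDist Y Z) :
    (ζ.comp η.cl).cl = (ζ.comp η).cl :=
  cl_eq_of_le (comp_cl_le (val_le_cl _)) fun x z =>
    (comp_le_comp (fun _ _ => le_rfl) η.val_le_cl x z).trans (val_le_cl _ x z)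

theorem id_comp (ζ : ContDist X Y) : (id X).comp ζ = ζ :=
  ext_val fun x y => le_antisymm (val_comp_le_iff.2 fun x' => ζ.left_act_le x x' y) (by
    refine le_trans ?_ ((id X).le_val_comp ζ x x y)
    simpa using comp_mono (X.cat.id_le x) (le_refl (ζ.val x y)))

theorem comp_id (ζ : ContDist X Y) : ζ.comp (id Y) = ζ :=
  ext_val fun x y => le_antisymm (val_comp_le_iff.2 fun y' => ζ.right_act_le x y' y) (by
    refine le_trans ?_ (ζ.le_val_comp (id Y) x y y)
    simpa using comp_mono (le_refl (ζ.val x y)) (Y.cat.id_le y))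

theorem comp_assoc (ζ : ContDist X Y) (η : ContDist Y Z) (θ : ContDist Z W) :
    (ζ.comp η).comp θ = ζ.comp (η.comp θ) :=
  ext_val fun x w => by
    change (⨆ z, (⨆ y, ζ.val x y ≫ η.val y z) ≫ θ.val z w) =
      ⨆ y, ζ.val x y ≫ ⨆ z, η.val y z ≫ θ.val z w
    simp only [comp_iSup, iSup_comp, Category.assoc]
    exact iSup_comm

end ContDist

/-- A closed continuous `Q`-distributor `(X, c) ⇸ (Y, d)`. -/
@[ext]
structure ClosedContDist (X Y : ClsSpace Q) extends ContDist X Y where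
  closed : toDist.IsClosed (X := X) (Y := Y)

namespace ClosedContDist

variable {X Y Z : ClsSpace Q}

/-- The closure of a continuous distributor as a closed continuous distributor. -/
def ofCl (ζ : ContDist X Y) : ClosedContDist X Y := ⟨ζ.cl, ζ.cl_isClosed⟩

theorem cl_eq (ζ : ClosedContDist X Y) : ζ.toContDist.cl = ζ.toContDist :=
  ContDist.ext_val fun x y => le_antisymm (isClosed_iff.1 ζ.closed x y) (ζ.val_le_cl x y)

theorem ext' {ζ η : ClosedContDist X Y} (h : ζ.toContDist = η.toContDist) : ζ = η := by
  cases ζ; cases η; cases h; rfl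

theorem ofCl_le {ζ : ContDist X Y} {η : ClosedContDist X Y} (h : ∀ x y, ζ.val x y ≤ η.val x y)
    (x : X.cat.Obj) (y : Y.cat.Obj) : (ofCl ζ).val x y ≤ η.val x y := by
  have := ContDist.cl_le (ζ := ζ) (η := η.toContDist) (by rwa [η.cl_eq]) x y
  rwa [η.cl_eq] at this

/-- The local order: pointwise. -/
instance : PartialOrder (ClosedContDist X Y) where
  le ζ η := ∀ x y, ζ.val x y ≤ η.val x y
  le_refl _ _ _ := le_rfl
  le_trans _ _ _ h h' x y := (h x y).trans (h' x y)
  le_antisymm _ _ h h' := ext' (ContDist.ext_val fun x y => le_antisymm (h x y) (h' x y))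

/-- The local join: the closure of the join of continuous distributors. -/
instance : SupSet (ClosedContDist X Y) where
  sSup S := ofCl (ContDist.sup (ClosedContDist.toContDist '' S))

theorem isLUB_sSup (S : Set (ClosedContDist X Y)) : IsLUB S (sSup S) := by
  constructor
  · intro ζ hζ x y
    refine le_trans ?_ (ContDist.val_le_cl _ x y)
    exact le_iSup₂_of_le ζ.toDist ⟨_, ⟨ζ, hζ, rfl⟩, rfl⟩ le_rfl
  · intro η hη
    refine ofCl_le fun x y => iSup₂_le ?_
    rintro _ ⟨_, ⟨ζ, hζ, rfl⟩, rfl⟩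
    exact hη hζ x y

instance : CompleteLattice (ClosedContDist X Y) :=
  completeLatticeOfSup _ isLUB_sSup

end ClosedContDist

variable (Q) in
/-- The objects of the quotient quantaloid: all `Q`-closure spaces. -/
structure ClsCloDist where
  space : ClsSpace Q

namespace ClsCloDist

/-- The category of `Q`-closure spaces and closed continuous `Q`-distributors: the quotient by the
nucleus `cl`, so identities are `cl (id)` and composites are `cl (η ∘ ζ)`. -/
instance : Category.{u} (ClsCloDist Q) where
  Hom X Y := ClosedContDist X.space Y.space
  id X := ClosedContDist.ofCl (ContDist.id X.space)
  comp ζ η := ClosedContDist.ofCl (ζ.toContDist.comp η.toContDist)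
  id_comp ζ := ClosedContDist.ext' (by
    change (ContDist.comp (ContDist.cl _) _).cl = _
    rw [ContDist.cl_cl_comp, ContDist.id_comp, ClosedContDist.cl_eq])
  comp_id ζ := ClosedContDist.ext' (by
    change (ContDist.comp _ (ContDist.cl _)).cl = _
    rw [ContDist.cl_comp_cl, ContDist.comp_id, ClosedContDist.cl_eq])
  assoc ζ η θ := ClosedContDist.ext' (by
    change (ContDist.comp (ContDist.cl _) _).cl = (ContDist.comp _ (ContDist.cl _)).cl
    rw [ContDist.cl_cl_comp, ContDist.cl_comp_cl, ContDist.comp_assoc])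

theorem comp_mono' {X Y Z : ClsCloDist Q} {ζ ζ' : ClosedContDist X.space Y.space}
    {η η' : ClosedContDist Y.space Z.space} (h : ζ ≤ ζ') (h' : η ≤ η') :
    ClosedContDist.ofCl (ζ.toContDist.comp η.toContDist) ≤
      ClosedContDist.ofCl (ζ'.toContDist.comp η'.toContDist) :=
  ClosedContDist.ofCl_le fun x z =>
    (ContDist.comp_le_comp h h' x z).trans (ContDist.val_le_cl _ x z)

instance (X Y : ClsCloDist Q) : CompleteLattice (X ⟶ Y) :=
  inferInstanceAs (CompleteLattice (ClosedContDist X.space Y.space))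

/-- The quantaloid structure of the quotient: pointwise order, joins closed up by `cl`. -/
instance : Quantaloid (ClsCloDist Q) where
  homLattice _ _ := inferInstance
  comp_sSup {X Y Z} ζ S := by
    refine le_antisymm ?_ (iSup₂_le fun η hη =>
      comp_mono' (Q := Q) (X := X) (Y := Y) (Z := Z) le_rfl (le_sSup hη))
    set R : X ⟶ Z := ⨆ g ∈ S, ζ ≫ g with hR
    have key : ∀ η ∈ S, ∀ x y z, ζ.val x y ≫ η.val y z ≤ R.val x z := fun η hη x y z =>
      ((ContDist.le_val_comp ζ.toContDist η.toContDist x y z).trans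
        (ContDist.val_le_cl _ x z)).trans ((le_iSup₂ (f := fun g (_ : g ∈ S) => ζ ≫ g) η hη) x z)
    refine ClosedContDist.ofCl_le (η := R) fun x z => ?_
    rw [← R.cl_eq]
    refine ContDist.comp_cl_le (θ := R.toContDist) (fun x z => ?_) x z
    rw [R.cl_eq]
    refine ContDist.val_comp_le_iff.2 fun y => ?_
    refine (le_of_eq (comp_iSup _ _)).trans (iSup_le fun φ => ?_)
    rw [comp_iSup]
    refine iSup_le ?_
    rintro ⟨_, ⟨η, hη, rfl⟩, rfl⟩
    exact key η hη x y z
  sSup_comp {X Y Z} S η := by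
    refine le_antisymm ?_ (iSup₂_le fun ζ hζ =>
      comp_mono' (Q := Q) (X := X) (Y := Y) (Z := Z) (le_sSup hζ) le_rfl)
    set R : X ⟶ Z := ⨆ g ∈ S, g ≫ η with hR
    have key : ∀ ζ ∈ S, ∀ x y z, ζ.val x y ≫ η.val y z ≤ R.val x z := fun ζ hζ x y z =>
      ((ContDist.le_val_comp ζ.toContDist η.toContDist x y z).trans
        (ContDist.val_le_cl _ x z)).trans ((le_iSup₂ (f := fun g (_ : g ∈ S) => g ≫ η) ζ hζ) x z)
    refine ClosedContDist.ofCl_le (η := R) fun x z => ?_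
    rw [← R.cl_eq]
    refine ContDist.cl_comp_le (θ := R.toContDist) (fun x z => ?_) x z
    rw [R.cl_eq]
    refine ContDist.val_comp_le_iff.2 fun y => ?_
    refine (le_of_eq (iSup_comp _ _)).trans (iSup_le fun φ => ?_)
    rw [iSup_comp]
    refine iSup_le ?_
    rintro ⟨_, ⟨ζ, hζ, rfl⟩, rfl⟩
    exact key ζ hζ x y z

end ClsCloDist

end QEnr

/-! ### Preliminaries on closure operators and residuation -/

namespace QEnr

variable {Q : Type u} [SmallCategory Q] [Quantaloid Q]

/-! A closed continuous distributor `ζ : (X, c) → (Y, d)` sends a closed presheaf `λ` on `Y` to `c(λ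
∘ ζ)` on `X`. This map has a right adjoint, `μ ↦ μ ↙ ζ`, and `ζ` can be read off from it. So the
category behaves like the opposite of complete `Q`-categories and left adjoints: there, limits are
families compatible with the left adjoints, and colimits are families compatible with the right
adjoints. The duality itself is not set up; it only suggests which closure spaces to take, and their
universal properties are checked by residuation.

Colimits. The objects of the space are all families `l` of closed presheaves with `l_j = c_j(l_k ∘
F(u))` for `u : j → k`. The closure is the largest one for which evaluation `ev_j(x, l) = l_j(x)` is
continuous. The columns of a cocone are exactly such families, so a point `w` of its vertex names an
object `s(w)`, and the mediating arrow is `(l, w) ↦ hom(l, s(w))`. It is unique because its columns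
are closed and the closure is determined by the evaluations.

Limits. The objects are the disjoint sum of the objects of the spaces. Families `n` with `n_k = n_j
↙ F(u)` serve as test presheaves: they determine both the hom-arrows and the closure. All
representables are then closed, so composing an arrow with a projection just selects columns
(`comp_limitProj_val`). The lift must therefore be the collection of all columns of the cone. That
it is a continuous distributor follows because every closed presheaf `ρ` on the vertex gives a test
family `ρ ↙ s.π` (`CocompatFamily.ofCone`). -/

/-- A closure operator on `P X` from a type-preserving operation on presheaves, given by its values
`a μ x : |x| ⟶ |μ|`. -/
@[reducible]
def ClosureOp.ofVal {X : QCat Q} (a : ∀ (μ : Presheaf X) (x : X.Obj), X.typ x ⟶ μ.typ)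
    (act : ∀ μ x' x, X.hom x' x ≫ a μ x ≤ a μ x')
    (map : ∀ (μ ν : Presheaf X) (s : μ.typ ⟶ ν.typ), (∀ x, μ.val x ≫ s ≤ ν.val x) →
      ∀ x, a μ x ≫ s ≤ a ν x)
    (le : ∀ μ x, μ.val x ≤ a μ x)
    (idem : ∀ μ x, a ⟨μ.typ, a μ, act μ⟩ x ≤ a μ x) : ClosureOp X.psh where
  obj := fun μ : Presheaf X => (⟨μ.typ, a μ, act μ⟩ : Presheaf X)
  typ_obj _ := rfl
  hom_le := fun μ ν : Presheaf X => by
    simp only [eqToHom_refl, Category.id_comp, Category.comp_id]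
    exact (le_psh_hom (μ := ⟨μ.typ, a μ, act μ⟩) (ν := ⟨ν.typ, a ν, act ν⟩)).2 fun x =>
      map μ ν _ (le_psh_hom.1 le_rfl) x
  le_obj := fun μ : Presheaf X => psh_le_iff.2 ⟨rfl, fun x => by simpa using le μ x⟩
  obj_obj_le := fun μ : Presheaf X => psh_le_iff.2 ⟨rfl, fun x => by simpa using idem μ x⟩

/-- Monotonicity and idempotence of the closure in one statement. Both presheaves have literally the
type `q`, so no transport along an equality of types appears. -/
theorem ClsSpace.app_le_app (X : ClsSpace Q) {q : Q} {a b : ∀ x, X.cat.typ x ⟶ q}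
    {ha : ∀ x' x, X.cat.hom x' x ≫ a x ≤ a x'} {hb : ∀ x' x, X.cat.hom x' x ≫ b x ≤ b x'}
    (h : ∀ x, a x ≤ X.app ⟨q, b, hb⟩ x) (x : X.cat.Obj) :
    X.app ⟨q, a, ha⟩ x ≤ X.app ⟨q, b, hb⟩ x := by
  have := X.app_comp_le (μ := ⟨q, a, ha⟩) (ν := ⟨q, b, hb⟩) (s := 𝟙 q)
    (fun x => by simpa using h x) x
  simpa using this

/-- Used with `𝟙 ≤ hom x x` to place an arrow below one term of a join, in the manner of the Yoneda
lemma. -/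
theorem le_comp_of_id_le {p q : Q} {e : p ⟶ p} (he : 𝟙 p ≤ e) (f : p ⟶ q) : f ≤ e ≫ f := by
  simpa using comp_mono he (le_refl f)

theorem le_comp_of_le_id {p q : Q} {e : q ⟶ q} (he : 𝟙 q ≤ e) (f : p ⟶ q) : f ≤ f ≫ e := by
  simpa using comp_mono (le_refl f) he

theorem comp_le_of_assoc_left {p q r s : Q} {f : p ⟶ q} {g : q ⟶ r} {h : r ⟶ s} {k : p ⟶ r}
    {t : p ⟶ s} (h₁ : f ≫ g ≤ k) (h₂ : k ≫ h ≤ t) : f ≫ g ≫ h ≤ t := by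
  rw [← Category.assoc]
  exact (comp_mono h₁ le_rfl).trans h₂

theorem comp_le_of_assoc_right {p q r s : Q} {f : p ⟶ q} {g : q ⟶ r} {h : r ⟶ s} {k : q ⟶ s}
    {t : p ⟶ s} (h₁ : g ≫ h ≤ k) (h₂ : f ≫ k ≤ t) : (f ≫ g) ≫ h ≤ t := by
  rw [Category.assoc]
  exact (comp_mono le_rfl h₁).trans h₂

/-! ### Residuals of families of arrows -/

section Largest

variable {p q : Q} {ι : Sort*} {r : ι → Q}

/-- The largest `g` with `a i ≫ g ≤ b i` for all `i`. -/
def leftPolar (a : ∀ i, r i ⟶ p) (b : ∀ i, r i ⟶ q) : p ⟶ q := ⨅ i, leftImp (b i) (a i)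

theorem le_leftPolar {a : ∀ i, r i ⟶ p} {b : ∀ i, r i ⟶ q} {g : p ⟶ q} :
    g ≤ leftPolar a b ↔ ∀ i, a i ≫ g ≤ b i := by
  simp only [leftPolar, le_iInf_iff, le_leftImp]

theorem comp_leftPolar_le (a : ∀ i, r i ⟶ p) (b : ∀ i, r i ⟶ q) (i : ι) :
    a i ≫ leftPolar a b ≤ b i :=
  le_leftPolar.1 le_rfl i

/-- The largest `g` with `g ≫ b i ≤ a i` for all `i`. -/
def rightPolar (a : ∀ i, p ⟶ r i) (b : ∀ i, q ⟶ r i) : p ⟶ q := sSup {g | ∀ i, g ≫ b i ≤ a i}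

/-- The supremum satisfies the bounds that define it because composition preserves joins in the
first variable. -/
theorem rightPolar_comp_le (a : ∀ i, p ⟶ r i) (b : ∀ i, q ⟶ r i) (i : ι) :
    rightPolar a b ≫ b i ≤ a i := by
  rw [rightPolar, Quantaloid.sSup_comp]
  exact iSup₂_le fun _ h => h i

theorem le_rightPolar {a : ∀ i, p ⟶ r i} {b : ∀ i, q ⟶ r i} {g : p ⟶ q} :
    g ≤ rightPolar a b ↔ ∀ i, g ≫ b i ≤ a i :=
  ⟨fun h i => (comp_mono h le_rfl).trans (rightPolar_comp_le a b i), fun h => le_sSup h⟩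

end Largest

/-! ### Pointwise calculus of arrows -/

namespace ClsCloDist

variable {X Y Z : ClsCloDist Q}

/-- The arrow of `ClsCloDist Q` given by a closed continuous distributor. -/
@[reducible]
def homMk (ζ : ClosedContDist X.space Y.space) : X ⟶ Y := ζ

/-- The closed continuous distributor underlying an arrow of `ClsCloDist Q`. -/
@[reducible]
def dist (ζ : X ⟶ Y) : ClosedContDist X.space Y.space := ζ

theorem hom_ext {ζ η : X ⟶ Y} (h : ∀ x y, (dist ζ).val x y = (dist η).val x y) : ζ = η :=
  ClosedContDist.ext' (ContDist.ext_val h)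

theorem val_comp_val_le (ζ : X ⟶ Y) (η : Y ⟶ Z) (x y z) :
    (dist ζ).val x y ≫ (dist η).val y z ≤ (dist (ζ ≫ η)).val x z :=
  (ContDist.le_val_comp (dist ζ).toContDist (dist η).toContDist x y z).trans
    (ContDist.val_le_cl _ x z)

theorem comp_val_le {ζ : X ⟶ Y} {η : Y ⟶ Z} {θ : X ⟶ Z}
    (h : ∀ x y z, (dist ζ).val x y ≫ (dist η).val y z ≤ (dist θ).val x z) (x z) :
    (dist (ζ ≫ η)).val x z ≤ (dist θ).val x z :=
  ClosedContDist.ofCl_le (η := dist θ) (fun x z => iSup_le fun y => h x y z) x z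

/-- Definitional, since `cl` acts column by column. It turns an equation between arrows into one
between closures of columns, which is the form of the compatibility condition on families. -/
theorem comp_val (ζ : X ⟶ Y) (η : Y ⟶ Z) (x z) :
    (dist (ζ ≫ η)).val x z =
      X.space.app (((dist ζ).toDist.comp (dist η).toDist).transpose z) x := rfl

theorem app_transpose_le (ζ : X ⟶ Y) (y x) :
    X.space.app ((dist ζ).transpose y) x ≤ (dist ζ).val x y :=
  isClosed_iff.1 (dist ζ).closed x y

/-! ### Colimits: families compatible with the left adjoints -/

section Colimit

variable {J : Type u} [SmallCategory J] (F : J ⥤ ClsCloDist Q)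

/-- A compatible family of closed presheaves on the spaces of a diagram: an element of the limit of
the lattices of closed presheaves. -/
structure CompatFamily where
  typ : Q
  val : ∀ j (x : (F.obj j).space.cat.Obj), (F.obj j).space.cat.typ x ⟶ typ
  act_le : ∀ j x' x, (F.obj j).space.cat.hom x' x ≫ val j x ≤ val j x'
  closed : ∀ j x, (F.obj j).space.app ⟨typ, val j, act_le j⟩ x ≤ val j x
  -- Given `closed`, this field and `le_app` are the two halves of `l_j = c_j(l_k ∘ F(u))`; no
  -- closure is needed in this half because `l_j` is closed.
  comp_le : ∀ {j k} (u : j ⟶ k) x y, (dist (F.map u)).val x y ≫ val k y ≤ val j x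
  le_app : ∀ {j k} (u : j ⟶ k) x, val j x ≤
    (F.obj j).space.app ((dist (F.map u)).star.obj ⟨typ, val k, act_le k⟩ : Presheaf _) x

/-- The `Q`-category of compatible families of closed presheaves. -/
@[reducible]
def colimitCat : QCat Q where
  Obj := CompatFamily F
  typ := CompatFamily.typ
  hom l m := leftPolar (ι := Σ j, (F.obj j).space.cat.Obj) (fun i => l.val i.1 i.2)
    fun i => m.val i.1 i.2
  id_le l := le_leftPolar.2 fun i => by simp
  comp_le l m n := le_leftPolar.2 fun i =>
    comp_le_of_assoc_left (k := m.val i.1 i.2)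
      (comp_leftPolar_le (fun i : Σ j, (F.obj j).space.cat.Obj => l.val i.1 i.2) _ i)
      (comp_leftPolar_le (fun i : Σ j, (F.obj j).space.cat.Obj => m.val i.1 i.2) _ i)

theorem val_comp_colimitCat_hom_le (l m : CompatFamily F) (j x) :
    l.val j x ≫ (colimitCat F).hom l m ≤ m.val j x :=
  comp_leftPolar_le (ι := Σ j, (F.obj j).space.cat.Obj) (fun i => l.val i.1 i.2)
    (fun i => m.val i.1 i.2) ⟨j, x⟩

theorem le_colimitCat_hom {l m : CompatFamily F} {g : l.typ ⟶ m.typ} :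
    g ≤ (colimitCat F).hom l m ↔ ∀ j x, l.val j x ≫ g ≤ m.val j x :=
  le_leftPolar.trans Sigma.forall

/-- The evaluation distributor from a space of the diagram to the compatible families. -/
@[reducible]
def evalDist (j : J) : Dist (F.obj j).space.cat (colimitCat F) :=
  Dist.mk' (fun x l => l.val j x) (fun x' x l => l.act_le j x' x)
    (fun x l m => val_comp_colimitCat_hom_le F l m j x)

/-- The closure `μ ↦ ⋀ j, c_j(μ ∘ ev_j) ↙ ev_j`, the largest one that makes all evaluations
continuous. -/
def colimitClose (μ : Presheaf (colimitCat F)) (l : CompatFamily F) : l.typ ⟶ μ.typ :=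
  leftPolar (ι := Σ j, (F.obj j).space.cat.Obj) (fun i => l.val i.1 i.2)
    fun i => (F.obj i.1).space.app ((evalDist F i.1).star.obj μ) i.2

theorem val_comp_colimitClose_le (μ : Presheaf (colimitCat F)) (l : CompatFamily F) (j x) :
    l.val j x ≫ colimitClose F μ l ≤ (F.obj j).space.app ((evalDist F j).star.obj μ) x :=
  comp_leftPolar_le (ι := Σ j, (F.obj j).space.cat.Obj) (fun i => l.val i.1 i.2)
    (fun i => (F.obj i.1).space.app ((evalDist F i.1).star.obj μ) i.2) ⟨j, x⟩

theorem le_colimitClose {μ : Presheaf (colimitCat F)} {l : CompatFamily F} {g : l.typ ⟶ μ.typ} :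
    g ≤ colimitClose F μ l ↔
      ∀ j x, l.val j x ≫ g ≤ (F.obj j).space.app ((evalDist F j).star.obj μ) x :=
  le_leftPolar.trans Sigma.forall

theorem hom_comp_colimitClose_le (μ : Presheaf (colimitCat F)) (l m : CompatFamily F) :
    (colimitCat F).hom l m ≫ colimitClose F μ m ≤ colimitClose F μ l :=
  (le_colimitClose F).2 fun j x =>
    comp_le_of_assoc_left (val_comp_colimitCat_hom_le F l m j x)
      (val_comp_colimitClose_le F μ m j x)

/-- By construction, evaluating the closure of `μ` at `j` stays below `c_j(μ ∘ ev_j)`, so a second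
closure gains nothing since `c_j` is idempotent. -/
theorem colimitClose_colimitClose_le (μ : Presheaf (colimitCat F)) (l : CompatFamily F) :
    colimitClose F ⟨μ.typ, colimitClose F μ, hom_comp_colimitClose_le F μ⟩ l ≤
      colimitClose F μ l :=
  (le_colimitClose F (μ := μ)).2 fun j x =>
    (val_comp_colimitClose_le F ⟨μ.typ, colimitClose F μ, hom_comp_colimitClose_le F μ⟩ l j x).trans
      ((F.obj j).space.app_le_app
        (fun x => iSup_le fun m => val_comp_colimitClose_le F μ m j x) x)

/-- The closure space of compatible families of closed presheaves. -/
@[reducible]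
def colimitSpace : ClsSpace Q where
  cat := colimitCat F
  op := ClosureOp.ofVal (colimitClose F)
    (hom_comp_colimitClose_le F)
    (fun μ ν s h l => (le_colimitClose F).2 fun j x =>
      comp_le_of_assoc_left (val_comp_colimitClose_le F μ l j x)
        ((F.obj j).space.app_comp_le (μ := (evalDist F j).star.obj μ)
          (ν := (evalDist F j).star.obj ν) (fun x => by
            refine le_trans ?_ ((F.obj j).space.val_le_app _ x)
            refine (le_of_eq (iSup_comp _ _)).trans (iSup_mono fun m => ?_)
            exact comp_le_of_assoc_right (h m) le_rfl) x))
    (fun μ l => (le_colimitClose F).2 fun j x =>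
      (le_iSup (fun l : CompatFamily F => l.val j x ≫ μ.val l) l).trans
        ((F.obj j).space.val_le_app ((evalDist F j).star.obj μ) x))
    (colimitClose_colimitClose_le F)

theorem colimitSpace_app (μ : Presheaf (colimitCat F)) (l : CompatFamily F) :
    (colimitSpace F).app μ l = colimitClose F μ l :=
  Category.comp_id _

/-- The evaluation as a closed continuous distributor. -/
@[reducible]
def colimitLeg (j : J) : F.obj j ⟶ ⟨colimitSpace F⟩ :=
  homMk (Y := ⟨colimitSpace F⟩)
    { toDist := evalDist F j
      cont := isContinuous_iff.2 fun μ x l => by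
        rw [colimitSpace_app]
        exact val_comp_colimitClose_le F μ l j x
      closed := isClosed_iff.2 fun x l => l.closed j x }

/-- The cocone of evaluations. -/
@[reducible]
def colimitCocone : Limits.Cocone F where
  pt := ⟨colimitSpace F⟩
  ι :=
    { app := colimitLeg F
      naturality := fun j k u => (hom_ext fun x l => le_antisymm
          (comp_val_le (ζ := F.map u) (η := colimitLeg F k) (θ := colimitLeg F j)
            (fun x y l => l.comp_le u x y) x l)
          (l.le_app u x) : F.map u ≫ colimitLeg F k = colimitLeg F j).trans
        (Category.comp_id _).symm }

variable {F}

/-- The compatible family `s.ι(-, w)` given by an element `w` of the vertex of a cocone `s`. -/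
def CompatFamily.ofCocone (s : Limits.Cocone F) (w : s.pt.space.cat.Obj) : CompatFamily F where
  typ := s.pt.space.cat.typ w
  val j x := (dist (s.ι.app j)).val x w
  act_le j x' x := (dist (s.ι.app j)).left_act_le x' x w
  closed j x := app_transpose_le (s.ι.app j) w x
  comp_le {j k} u x y := by
    rw [← s.w u]
    exact val_comp_val_le (F.map u) (s.ι.app k) x y w
  le_app {j k} u x := by
    conv_lhs => rw [← s.w u]
    exact le_of_eq (comp_val (F.map u) (s.ι.app k) x w)

/-- The value at `(l, w)` of the distributor induced by a cocone `s`: the arrow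
`⋀ j x, s.ι(x, w) ↙ l(x)`. -/
def descVal (s : Limits.Cocone F) (l : CompatFamily F) (w : s.pt.space.cat.Obj) :
    l.typ ⟶ s.pt.space.cat.typ w :=
  (colimitCat F).hom l (.ofCocone s w)

theorem le_descVal {s : Limits.Cocone F} {l : CompatFamily F} {w : s.pt.space.cat.Obj}
    {g : l.typ ⟶ s.pt.space.cat.typ w} :
    g ≤ descVal s l w ↔ ∀ j x, l.val j x ≫ g ≤ (dist (s.ι.app j)).val x w :=
  le_colimitCat_hom F (m := .ofCocone s w)

theorem val_comp_descVal_le (s : Limits.Cocone F) (l : CompatFamily F) (w : s.pt.space.cat.Obj)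
    (j x) : l.val j x ≫ descVal s l w ≤ (dist (s.ι.app j)).val x w :=
  le_descVal.1 le_rfl j x

/-- The distributor induced by a cocone. -/
@[reducible]
def descDist (s : Limits.Cocone F) : Dist (colimitCat F) s.pt.space.cat :=
  Dist.mk' (descVal s) (fun l m _ => (colimitCat F).comp_le l m _)
    (fun l w w' => le_descVal.2 fun j x =>
      comp_le_of_assoc_left (val_comp_descVal_le s l w j x)
        ((dist (s.ι.app j)).right_act_le x w w'))

/-- The term of the join at the family named by `w` itself suffices, since `descVal` there contains
an identity. Hence the cocone factors through the evaluations already before closing. -/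
theorem ι_val_le_iSup (s : Limits.Cocone F) (j x) (w : s.pt.space.cat.Obj) :
    (dist (s.ι.app j)).val x w ≤ ⨆ l : CompatFamily F, l.val j x ≫ descVal s l w :=
  (le_comp_of_le_id ((colimitCat F).id_le (.ofCocone s w)) _).trans
    (le_iSup (fun l : CompatFamily F => l.val j x ≫ descVal s l w) (.ofCocone s w))

/-- The closed continuous distributor induced by a cocone. -/
@[reducible]
def colimitDesc (s : Limits.Cocone F) : (⟨colimitSpace F⟩ : ClsCloDist Q) ⟶ s.pt :=
  homMk (X := ⟨colimitSpace F⟩)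
    { toDist := descDist s
      cont := isContinuous_iff.2 fun μ l w => by
        rw [colimitSpace_app]
        refine (le_colimitClose F (μ := (descDist s).star.obj μ)).2 fun j x => ?_
        refine comp_le_of_assoc_left (val_comp_descVal_le s l w j x) ?_
        refine ((dist (s.ι.app j)).le_app μ x w).trans ?_
        refine (F.obj j).space.app_le_app (fun x => ?_) x
        refine le_trans ?_
          ((F.obj j).space.val_le_app ((evalDist F j).star.obj ((descDist s).star.obj μ)) x)
        -- After continuity of the leg, each entry `s.ι_j(x, w)` is expanded through the compatible
        -- families, giving `μ ∘ desc ∘ ev_j`.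
        refine iSup_le fun w => (comp_mono (ι_val_le_iSup s j x w) le_rfl).trans ?_
        refine (le_of_eq (iSup_comp _ _)).trans (iSup_mono fun l => ?_)
        refine comp_le_of_assoc_right le_rfl (comp_mono le_rfl ?_)
        exact le_iSup (fun w => descVal s l w ≫ μ.val w) w
      closed := isClosed_iff.2 fun l w => by
        rw [colimitSpace_app]
        refine le_descVal.2 fun j x => (val_comp_colimitClose_le F _ l j x).trans ?_
        refine le_trans ?_ (app_transpose_le (s.ι.app j) w x)
        refine (F.obj j).space.app_le_app (fun x => ?_) x
        refine le_trans ?_ ((F.obj j).space.val_le_app ((dist (s.ι.app j)).transpose w) x)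
        exact iSup_le fun l => val_comp_descVal_le s l w j x }

/-- The space of compatible families is the colimit of the diagram. -/
def isColimitColimitCocone : Limits.IsColimit (colimitCocone F) where
  desc := colimitDesc
  fac s j := hom_ext fun x w => le_antisymm
    (comp_val_le (ζ := colimitLeg F j) (η := colimitDesc s) (θ := s.ι.app j)
      (fun x l w => val_comp_descVal_le s l w j x) x w)
    ((ι_val_le_iSup s j x w).trans
      (iSup_le fun l => val_comp_val_le (colimitLeg F j) (colimitDesc s) x l w))
  uniq s m hm := hom_ext fun l w => le_antisymm
    (le_descVal.2 fun j x => by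
      rw [← hm j]
      exact val_comp_val_le (colimitLeg F j) m x l w)
    (by
      -- The column `m(-, w)` is closed, so it is enough to land in its closure. That closure is
      -- tested at each `j` against `c_j(m(-, w) ∘ ev_j)`, which is the column at `w` of `ev_j ≫ m`,
      -- hence of the leg `s.ι_j`.
      refine le_trans ?_ (app_transpose_le (X := ⟨colimitSpace F⟩) m w l)
      refine le_trans ?_ (le_of_eq (colimitSpace_app F
        ((dist (X := ⟨colimitSpace F⟩) m).transpose w) l).symm)
      refine (le_colimitClose F (μ := (dist (X := ⟨colimitSpace F⟩) m).transpose w)).2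
        fun j x => (val_comp_descVal_le s l w j x).trans ?_
      rw [← hm j]
      exact le_of_eq (comp_val (colimitLeg F j) m x w))

end Colimit

/-! ### Limits: families compatible with the right adjoints -/

section Limit

variable {J : Type u} [SmallCategory J] (F : J ⥤ ClsCloDist Q)

/-- A family of closed presheaves on the spaces of a diagram that is compatible with the right
adjoints `μ ↦ μ ↙ F(u)` of the maps between the lattices of closed presheaves. -/
structure CocompatFamily where
  typ : Q
  val : ∀ p : Σ j, (F.obj j).space.cat.Obj, (F.obj p.1).space.cat.typ p.2 ⟶ typ
  act_le : ∀ j x' x, (F.obj j).space.cat.hom x' x ≫ val ⟨j, x⟩ ≤ val ⟨j, x'⟩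
  closed : ∀ j x, (F.obj j).space.app ⟨typ, fun x => val ⟨j, x⟩, act_le j⟩ x ≤ val ⟨j, x⟩
  -- The equation `n_k = n_j ↙ F(u)`, stated through the universal property of the residual.
  le_iff : ∀ {j k} (u : j ⟶ k) y (g : (F.obj k).space.cat.typ y ⟶ typ),
    g ≤ val ⟨k, y⟩ ↔ ∀ x, (dist (F.map u)).val x y ≫ g ≤ val ⟨j, x⟩

/-- The sum of the underlying sets of the spaces, with the largest hom-arrows that make the
cocompatible families presheaves. -/
@[reducible]
def limitCat : QCat Q where
  Obj := Σ j, (F.obj j).space.cat.Obj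
  typ p := (F.obj p.1).space.cat.typ p.2
  hom p q := rightPolar (fun n : CocompatFamily F => n.val p) fun n => n.val q
  id_le p := le_rightPolar.2 fun n => by simp
  comp_le p q r := le_rightPolar.2 fun n =>
    comp_le_of_assoc_right (rightPolar_comp_le _ _ n) (rightPolar_comp_le _ _ n)

variable {F}

theorem limitCat_hom_comp_val_le (n : CocompatFamily F) (p q) :
    (limitCat F).hom p q ≫ n.val q ≤ n.val p :=
  rightPolar_comp_le (fun n : CocompatFamily F => n.val p) (fun n => n.val q) n

theorem le_limitCat_hom {p q : (limitCat F).Obj} {g : (limitCat F).typ p ⟶ (limitCat F).typ q} :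
    g ≤ (limitCat F).hom p q ↔ ∀ n : CocompatFamily F, g ≫ n.val q ≤ n.val p :=
  le_rightPolar

variable (F)

/-- The arrows `t` from the type of `μ` to that of a cocompatible family `n` with `t ∘ μ ≤ n`. -/
structure CocompatBound (μ : Presheaf (limitCat F)) where
  fam : CocompatFamily F
  arr : μ.typ ⟶ fam.typ
  le : ∀ p, μ.val p ≫ arr ≤ fam.val p

/-- The `Q`-enriched hull of a presheaf with respect to the cocompatible families. -/
def limitClose (μ : Presheaf (limitCat F)) (p : (limitCat F).Obj) : (limitCat F).typ p ⟶ μ.typ :=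
  rightPolar (fun b : CocompatBound F μ => b.fam.val p) fun b => b.arr

variable {F}

theorem limitClose_comp_le {μ : Presheaf (limitCat F)} {n : CocompatFamily F} {t : μ.typ ⟶ n.typ}
    (h : ∀ p, μ.val p ≫ t ≤ n.val p) (p : (limitCat F).Obj) : limitClose F μ p ≫ t ≤ n.val p :=
  rightPolar_comp_le (fun b : CocompatBound F μ => b.fam.val p) (fun b => b.arr) ⟨n, t, h⟩

theorem le_limitClose {μ : Presheaf (limitCat F)} {p : (limitCat F).Obj}
    {g : (limitCat F).typ p ⟶ μ.typ} :
    g ≤ limitClose F μ p ↔ ∀ (n : CocompatFamily F) (t : μ.typ ⟶ n.typ),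
      (∀ p, μ.val p ≫ t ≤ n.val p) → g ≫ t ≤ n.val p :=
  le_rightPolar.trans ⟨fun h n t ht => h ⟨n, t, ht⟩, fun h b => h _ _ b.le⟩

variable (F)

theorem hom_comp_limitClose_le (μ : Presheaf (limitCat F)) (p q) :
    (limitCat F).hom p q ≫ limitClose F μ q ≤ limitClose F μ p :=
  le_limitClose.2 fun n _ h =>
    comp_le_of_assoc_right (limitClose_comp_le h q) (limitCat_hom_comp_val_le n p q)

/-- Every test family bounding `μ` along `t` also bounds its hull along `t`. -/
theorem limitClose_limitClose_le (μ : Presheaf (limitCat F)) (p) :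
    limitClose F ⟨μ.typ, limitClose F μ, hom_comp_limitClose_le F μ⟩ p ≤ limitClose F μ p :=
  (le_limitClose (μ := μ)).2 fun _ _ h =>
    limitClose_comp_le (μ := ⟨μ.typ, limitClose F μ, hom_comp_limitClose_le F μ⟩)
      (fun p => limitClose_comp_le h p) p

/-- The closure space on the sum of the spaces of a diagram defined by the cocompatible families. -/
@[reducible]
def limitSpace : ClsSpace Q where
  cat := limitCat F
  op := ClosureOp.ofVal (limitClose F)
    (hom_comp_limitClose_le F)
    (fun μ ν s hs p => le_limitClose.2 fun n t h => by
      rw [Category.assoc]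
      exact limitClose_comp_le (fun p => comp_le_of_assoc_left (hs p) (h p)) p)
    (fun μ p => le_limitClose.2 fun n t h => h p)
    (limitClose_limitClose_le F)

theorem limitSpace_app (μ : Presheaf (limitCat F)) (p : (limitCat F).Obj) :
    (limitSpace F).app μ p = limitClose F μ p :=
  Category.comp_id _

/-- The cograph of the inclusion of a space of the diagram into the sum. -/
@[reducible]
def projDist (j : J) : Dist (limitCat F) (F.obj j).space.cat :=
  Dist.mk' (fun p x => (limitCat F).hom p ⟨j, x⟩) (fun p q _ => (limitCat F).comp_le p q _)
    (fun p x y => (le_limitCat_hom (p := p) (q := ⟨j, y⟩)).2 fun n =>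
      comp_le_of_assoc_right (n.act_le j x y)
        (limitCat_hom_comp_val_le n p ⟨j, x⟩))

/-- The projection as a closed continuous distributor. -/
@[reducible]
def limitProj (j : J) : (⟨limitSpace F⟩ : ClsCloDist Q) ⟶ F.obj j :=
  homMk (X := ⟨limitSpace F⟩)
    { toDist := projDist F j
      cont := isContinuous_iff.2 fun μ p y => by
        rw [limitSpace_app]
        refine (le_limitClose (μ := (projDist F j).star.obj μ)).2 fun n t h => ?_
        -- Restricted to the summand `j`, the bound `h` says `t ∘ μ ≤ n_j`; since `n_j` is closed
        -- for `c_j`, the bound passes to `c_j μ`.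
        refine comp_le_of_assoc_right (k := n.val ⟨j, y⟩) ?_ (limitCat_hom_comp_val_le n p ⟨j, y⟩)
        refine le_trans ?_ (n.closed j y)
        refine (F.obj j).space.app_comp_le (μ := μ) (ν := ⟨n.typ, _, n.act_le j⟩) (fun x => ?_) y
        refine le_trans ?_ ((F.obj j).space.val_le_app _ x)
        refine le_trans (comp_mono ?_ le_rfl) (h ⟨j, x⟩)
        exact (le_comp_of_id_le ((limitCat F).id_le ⟨j, x⟩) _).trans
          (le_iSup (fun y => (limitCat F).hom ⟨j, x⟩ ⟨j, y⟩ ≫ μ.val y) x)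
      closed := isClosed_iff.2 fun p x => by
        rw [limitSpace_app]
        -- Representables are closed: each test family `n` bounds `hom(-, q)` along `n(q)`, and
        -- these bounds define `hom(-, q)`.
        exact (le_limitCat_hom (p := p) (q := ⟨j, x⟩)).2 fun n =>
          limitClose_comp_le (μ := (projDist F j).transpose x)
            (fun p => limitCat_hom_comp_val_le n p ⟨j, x⟩) p }

/-- The cone of projections. -/
@[reducible]
def limitCone : Limits.Cone F where
  pt := ⟨limitSpace F⟩
  π :=
    { app := limitProj F
      naturality := fun j k u => (Category.id_comp _).trans (hom_ext fun p y => le_antisymm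
          (by
            refine le_trans ?_ (le_of_eq (comp_val (limitProj F j) (F.map u) p y).symm)
            refine le_trans ?_ (le_of_eq (limitSpace_app F
              (((projDist F j).comp (dist (F.map u)).toDist).transpose y) p).symm)
            refine (le_limitClose (μ := ((projDist F j).comp (dist (F.map u)).toDist).transpose y)).2
              fun n t h => ?_
            -- It remains to show `t ≤ n_k(y)`. By `le_iff` this can be tested at the points `x` of
            -- the space at `j`, where `h` at `(j, x)` and the identity below `hom` give it.
            refine (comp_mono le_rfl ?_).trans (limitCat_hom_comp_val_le n p ⟨k, y⟩)
            refine (n.le_iff u y t).2 fun x => ?_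
            refine le_trans (comp_mono ?_ le_rfl) (h ⟨j, x⟩)
            exact (le_comp_of_id_le ((limitCat F).id_le ⟨j, x⟩) _).trans
              (le_iSup (fun x' => (limitCat F).hom ⟨j, x⟩ ⟨j, x'⟩ ≫ (dist (F.map u)).val x' y) x))
          (comp_val_le (ζ := limitProj F j) (η := F.map u) (θ := limitProj F k)
            (fun p x y => (le_limitCat_hom (p := p) (q := ⟨k, y⟩)).2 fun n =>
              comp_le_of_assoc_right ((n.le_iff u y _).1 le_rfl x)
                (limitCat_hom_comp_val_le n p ⟨j, x⟩)) p y) :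
          limitProj F k = limitProj F j ≫ F.map u) }

/-- A leg of a cone `s` over `F` as an arrow from the vertex of `s`. -/
@[reducible]
def coneLeg {F : J ⥤ ClsCloDist Q} (s : Limits.Cone F) (j : J) : s.pt ⟶ F.obj j := s.π.app j

/-- The projection is representable in its first argument and `m(-, (j, x))` is closed, so neither
the composition nor its closure changes the column. This gives both the factorisation and its
uniqueness. -/
theorem comp_limitProj_val {W : ClsCloDist Q} (m : W ⟶ ⟨limitSpace F⟩) (j w x) :
    (dist (m ≫ limitProj F j)).val w x = (dist m).val w ⟨j, x⟩ := by
  refine le_antisymm ?_ ?_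
  · refine le_trans ?_ (app_transpose_le m ⟨j, x⟩ w)
    rw [comp_val]
    refine W.space.app_le_app (fun w => le_trans ?_
      (W.space.val_le_app ((dist m).transpose ⟨j, x⟩) w)) w
    exact iSup_le fun p => (dist m).right_act_le w p ⟨j, x⟩
  · exact (le_comp_of_le_id ((limitCat F).id_le ⟨j, x⟩) _).trans
      (val_comp_val_le m (limitProj F j) w ⟨j, x⟩ x)

variable {F}

/-- The cocompatible family `x ↦ ρ ↙ s.π(-, x)` given by a closed presheaf `ρ` on the vertex of a
cone `s`. -/
def CocompatFamily.ofCone (s : Limits.Cone F) (ρ : Presheaf s.pt.space.cat)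
    (hρ : ∀ w, s.pt.space.app ρ w ≤ ρ.val w) : CocompatFamily F where
  typ := ρ.typ
  val p := leftPolar (fun w => (dist (coneLeg s p.1)).val w p.2) ρ.val
  act_le j x' x := le_leftPolar.2 fun w =>
    comp_le_of_assoc_left ((dist (coneLeg s j)).right_act_le w x' x)
      (comp_leftPolar_le (fun w => (dist (coneLeg s j)).val w x) ρ.val w)
  closed j x := le_leftPolar.2 fun w => by
    -- Continuity of the leg moves `c_j` outside as the closure of the vertex, which the closed
    -- presheaf `ρ` absorbs.
    refine ((dist (coneLeg s j)).le_app _ w x).trans (le_trans ?_ (hρ w))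
    refine s.pt.space.app_le_app (fun w => ?_) w
    refine le_trans ?_ (s.pt.space.val_le_app _ w)
    exact iSup_le fun x => comp_leftPolar_le (fun w => (dist (coneLeg s j)).val w x) ρ.val w
  le_iff {j k} u y g := by
    refine le_leftPolar.trans ⟨fun h x => le_leftPolar.2 fun w => ?_, fun h w => ?_⟩
    · refine comp_le_of_assoc_left ?_ (h w)
      refine le_of_le_of_eq ?_ (congrArg (fun f => (dist f).val w y) (s.w u))
      exact val_comp_val_le (coneLeg s j) (F.map u) w x y
    -- The leg at `k` is the closure of `F(u) ∘ s.π_j`; as `ρ` is closed, a bound by `ρ` may be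
    -- checked before closing.
    · have hw : (dist (coneLeg s k)).val w y = (dist (coneLeg s j ≫ F.map u)).val w y :=
        congrArg (fun f => (dist f).val w y) (s.w u).symm
      refine (comp_mono hw.le le_rfl).trans (le_trans ?_ (hρ w))
      refine s.pt.space.app_comp_le (fun w => le_trans ?_ (s.pt.space.val_le_app _ w)) w
      refine (le_of_eq (iSup_comp _ _)).trans (iSup_le fun x => ?_)
      exact comp_le_of_assoc_right (h x)
        (comp_leftPolar_le (fun w => (dist (coneLeg s j)).val w x) ρ.val w)

theorem le_ofCone_val (s : Limits.Cone F) (ρ : Presheaf s.pt.space.cat)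
    (hρ : ∀ w, s.pt.space.app ρ w ≤ ρ.val w) (p : (limitCat F).Obj)
    {g : (limitCat F).typ p ⟶ ρ.typ} :
    g ≤ (CocompatFamily.ofCone s ρ hρ).val p ↔
      ∀ w, (dist (coneLeg s p.1)).val w p.2 ≫ g ≤ ρ.val w :=
  le_leftPolar

/-- The distributor induced by a cone. -/
@[reducible]
def liftDist (s : Limits.Cone F) : Dist s.pt.space.cat (limitCat F) :=
  Dist.mk' (fun w p => (dist (coneLeg s p.1)).val w p.2)
    (fun w' w p => (dist (coneLeg s p.1)).left_act_le w' w p.2)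
    (fun w p q => by
      -- The test family of the column `ρ` of the cone at `q` has an identity below its value at
      -- `q`. Hence `hom p q` lies below its value at `p`, which unfolds to the action inequality.
      let ρ := (dist (coneLeg s q.1)).transpose q.2
      have hρ := app_transpose_le (coneLeg s q.1) q.2
      have h : 𝟙 _ ≤ (CocompatFamily.ofCone s ρ hρ).val q :=
        (le_ofCone_val s ρ hρ q).2 fun w => (Category.comp_id _).le
      exact (le_ofCone_val s ρ hρ p).1
        ((le_comp_of_le_id h _).trans (limitCat_hom_comp_val_le _ p q)) w)

/-- The closed continuous distributor induced by a cone. -/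
@[reducible]
def limitLift (s : Limits.Cone F) : s.pt ⟶ (⟨limitSpace F⟩ : ClsCloDist Q) :=
  homMk (Y := ⟨limitSpace F⟩)
    { toDist := liftDist s
      cont := isContinuous_iff.2 fun μ w p => by
        rw [limitSpace_app]
        -- The target of the continuity inequality is itself taken as `ρ`. Its test family bounds
        -- `μ` along the identity, hence bounds the hull of `μ`, and this is continuity by
        -- adjunction.
        let ρ : Presheaf s.pt.space.cat := ⟨μ.typ, s.pt.space.app ((liftDist s).star.obj μ),
          s.pt.space.act_app_le _⟩
        have hρ : ∀ w, s.pt.space.app ρ w ≤ ρ.val w :=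
          s.pt.space.app_le_app (fun _ => le_rfl)
        have h : ∀ p, μ.val p ≫ 𝟙 μ.typ ≤ (CocompatFamily.ofCone s ρ hρ).val p := fun p => by
          refine (Category.comp_id _).le.trans ((le_ofCone_val s ρ hρ p).2 fun w => ?_)
          exact (le_iSup (fun p => (liftDist s).val w p ≫ μ.val p) p).trans
            (s.pt.space.val_le_app ((liftDist s).star.obj μ) w)
        exact (le_ofCone_val s ρ hρ p).1 ((Category.comp_id _).ge.trans
          (limitClose_comp_le (μ := μ) (n := .ofCone s ρ hρ) h p)) w
      closed := isClosed_iff.2 fun w (p : (limitCat F).Obj) => by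
        exact app_transpose_le (coneLeg s p.1) p.2 w }

/-- The sum with the closure defined by the cocompatible families is the limit of the diagram. -/
def isLimitLimitCone : Limits.IsLimit (limitCone F) where
  lift := limitLift
  fac s j := hom_ext fun w x => comp_limitProj_val F (limitLift s) j w x
  uniq s m hm := hom_ext fun w (p : (limitCat F).Obj) =>
    (comp_limitProj_val F m p.1 w p.2).symm.trans
      (congrArg (fun f : s.pt ⟶ F.obj p.1 => (dist f).val w p.2) (hm p.1))

end Limit

end ClsCloDist

end QEnr

theorem corollary4p13 {Q : Type u} [SmallCategory Q] [QEnr.Quantaloid Q] :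
    Limits.HasLimits (QEnr.ClsCloDist Q) ∧ Limits.HasColimits (QEnr.ClsCloDist Q) :=
  ⟨⟨fun _ _ => ⟨fun _ => ⟨⟨_, QEnr.ClsCloDist.isLimitLimitCone⟩⟩⟩⟩,
    ⟨fun _ _ => ⟨fun _ => ⟨⟨_, QEnr.ClsCloDist.isColimitColimitCocone⟩⟩⟩⟩⟩
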